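/- Let $m\ge 2$ and let $\mathcal{A}=(a_{i_1\cdots i_m})$, $i_1,\dots,i_m\in\{1,\dots,n\}$, be a real $m$th order $n$-dimensional tensor. For ${\bf x}\in\mathbb{R}^n$ let $\mathcal{A}{\bf x}^{m-1}\in\mathbb{R}^n$ be the vector with components $$(\mathcal{A}{\bf x}^{m-1})_i=\sum_{i_2,\dots,i_m=1}^n a_{ii_2\cdots i_m}x_{i_2}\cdots x_{i_m},\qquad i=1,\dots,n.$$ Vector inequalities are understood componentwise. The tensor $\mathcal{A}$ is called an R-tensor if there are no ${\bf x}\in\mathbb{R}^n$ and $t\in\mathbb{R}$ with ${\bf 0}\neq{\bf x}\ge{\bf 0}$ and $t\ge 0$ such that $(\mathcal{A}{\bf x}^{m-1})_i+t=0$ for every $i$ with $x_i>0$ and $(\mathcal{A}{\bf x}^{m-1})_j+t\ge 0$ for every $j$ with $x_j=0$. It is called a Q-tensor if for every ${\bf q}\in\mathbb{R}^n$ the tensor complementarity problem $({\bf q},\mathcal{A})$ has a solution, that is, there is ${\bf x}\in\mathbb{R}^n$ with $${\bf x}\ge{\bf 0},\qquad {\bf q}+\mathcal{A}{\bf x}^{m-1}\ge{\bf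 0},\qquad {\bf x}^\top({\bf q}+\mathcal{A}{\bf x}^{m-1})=0.$$ Then every R-tensor is a Q-tensor. -/

import Mathlib

/-- Real `m`th order `n`-dimensional tensors (hypermatrices) `(a_{i₁⋯iₘ})`, with each index ranging
over `Fin n`. -/
abbrev RealTensor (m n : ℕ) : Type := (Fin m → Fin n) → ℝ

namespace RealTensor

/-- The multi-index `(i, i₂, …, iₘ)` of length `m`, built from a first index `i` and the remaining
`m - 1` indices. -/
def consIndex {m n : ℕ} (i : Fin n) (r : Fin (m - 1) → Fin n) : Fin m → Fin n :=
  fun j => if h : j.val = 0 then i else r ⟨j.val - 1, by have := j.isLt; omega⟩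

/-- The vector `𝒜 x^{m-1}`, with components
`(𝒜 x^{m-1})_i = ∑_{i₂,…,iₘ} a_{i i₂ ⋯ iₘ} x_{i₂} ⋯ x_{iₘ}`. -/
def mulVecPow {m n : ℕ} (A : RealTensor m n) (x : Fin n → ℝ) : Fin n → ℝ :=
  fun i => ∑ r : Fin (m - 1) → Fin n, A (consIndex i r) * ∏ j, x (r j)

/-- `x` solves the tensor complementarity problem `(q, 𝒜)`:
`x ≥ 0`, `q + 𝒜 x^{m-1} ≥ 0` and `xᵀ (q + 𝒜 x^{m-1}) = 0` (componentwise order). -/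
def IsTCPSolution {m n : ℕ} (q : Fin n → ℝ) (A : RealTensor m n) (x : Fin n → ℝ) : Prop :=
  0 ≤ x ∧ 0 ≤ q + A.mulVecPow x ∧ dotProduct x (q + A.mulVecPow x) = 0

/-- `𝒜` is a Q-tensor: `(q, 𝒜)` has a solution for every `q`. -/
def IsQTensor {m n : ℕ} (A : RealTensor m n) : Prop :=
  ∀ q : Fin n → ℝ, ∃ x : Fin n → ℝ, IsTCPSolution q A x

/-- `𝒜` is an R-tensor: there are no `0 ≠ x ≥ 0` and `t ≥ 0` with `(𝒜 x^{m-1})_i + t = 0` whenever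
`x_i > 0` and `(𝒜 x^{m-1})_j + t ≥ 0` whenever `x_j = 0`. -/
def IsRTensor {m n : ℕ} (A : RealTensor m n) : Prop :=
  ¬ ∃ (x : Fin n → ℝ) (t : ℝ), x ≠ 0 ∧ 0 ≤ x ∧ 0 ≤ t ∧
    (∀ i, 0 < x i → A.mulVecPow x i + t = 0) ∧
    (∀ j, x j = 0 → 0 ≤ A.mulVecPow x j + t)

end RealTensor

/-!
An R-tensor is a Q-tensor because the variational inequality for `x ↦ 𝒜 x^{m-1} + q` on the
truncated orthant `{x ≥ 0 | ∑ x ≤ r}` always has a solution: if `∑ x < r` this solution solves the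
complementarity problem, and if `∑ x = r` it satisfies the complementarity conditions for
`𝒜 x^{m-1} + q + t 𝟙` with a multiplier `t ≥ 0`. Were the second case to occur for all `r`, then
after rescaling to `∑ x = 1` (`RealTensor.exists_boundary_variational`) a limit point as `r → ∞`
would be a vector excluded by the definition of an R-tensor, since the contribution of `q` vanishes
in the limit.

Solvability of the variational inequality on a simplex (`exists_variational_stdSimplex`) has the
strength of Brouwer's fixed point theorem. It is obtained from Scarf's combinatorial lemma
(`exists_isDominant_image_eq_univ`): rank the points of a fine grid by each of their coordinates,
add one slack point per coordinate, and colour a grid point by an index at which the map attains its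
smallest coordinate. A parity argument gives a dominant set in which every colour occurs exactly
once. Dominance forces the grid points of such a set to be close to each other and to the face
spanned by their colours (`exists_close_grid_points`), so that they converge to a solution as the
grid is refined. The parity argument rests on the fact that a dominant set which is one element
short has exactly two dominant one-point extensions
(`IsDominant.card_extensions_eq_two`), or only one if it consists of slack points
(`card_extensions_image_erase`).
-/

/-! ### Dominant sets and Scarf's parity argument -/

/-- A set `B` of points is dominant for a family `f` of rankings if no point `y` beats, in every
ranking, the worst element of `B`. -/
def IsDominant {I X L : Type*} [LinearOrder L] (f : I → X → L) (B : Finset X) : Prop :=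
  ∀ y, ∃ i, ∀ x ∈ B, f i y ≤ f i x

theorem IsDominant.mono {I X L : Type*} [LinearOrder L] {f : I → X → L} {B C : Finset X}
    (hC : IsDominant f C) (h : B ⊆ C) : IsDominant f B := fun y => by
  obtain ⟨i, hi⟩ := hC y
  exact ⟨i, fun x hx => hi x (h hx)⟩

/-- The points that beat the worst element `w k` of a set in every ranking `k` other than `i`. -/
def beatsExcept {I X L : Type*} [LinearOrder L] (f : I → X → L) (w : I → X) (i : I) : Set X :=
  {y | ∀ k, k ≠ i → f k (w k) < f k y}

/-- Let `w k` be the `k`-worst element of the dominant set `B`, and let the rankings `i` and `j`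
share their worst element. Then an `i`-best point among those beating `B` in all rankings except
`i` can be added to `B`. -/
theorem IsDominant.insert_of_beatsExcept {I X L : Type*} [DecidableEq X] [LinearOrder L]
    {f : I → X → L} {B : Finset X} (hB : IsDominant f B) {w : I → X} (hw : ∀ k, w k ∈ B)
    (hmin : ∀ k, ∀ x ∈ B, f k (w k) ≤ f k x) (hsurj : ∀ x ∈ B, ∃ k, w k = x)
    {i j : I} (hij : i ≠ j) (hwij : w i = w j) {x : X} (hx : x ∈ beatsExcept f w i)
    (hmax : ∀ y ∈ beatsExcept f w i, f i y ≤ f i x) :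
    x ∉ B ∧ IsDominant f (insert x B) := by
  constructor
  · intro hxB
    obtain ⟨k, rfl⟩ := hsurj x hxB
    by_cases hk : k = i
    · subst hk
      have := hx j hij.symm
      rw [hwij] at this
      exact lt_irrefl _ this
    · exact lt_irrefl _ (hx k hk)
  · intro y
    by_cases hy : y ∈ beatsExcept f w i
    · obtain ⟨k, hk⟩ := hB y
      obtain rfl : k = i := by
        by_contra hki
        exact absurd (hy k hki) (hk _ (hw k)).not_gt
      refine ⟨k, fun z hz => ?_⟩
      rcases Finset.mem_insert.1 hz with rfl | hz
      · exact hmax y hy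
      · exact hk z hz
    · simp only [beatsExcept, Set.mem_ofPred_eq, not_forall, not_lt] at hy
      obtain ⟨k, hki, hk⟩ := hy
      refine ⟨k, fun z hz => ?_⟩
      rcases Finset.mem_insert.1 hz with rfl | hz
      · exact hk.trans (hx k hki).le
      · exact hk.trans (hmin k z hz)

/-- Conversely, a point whose addition keeps `B` dominant and which becomes the worst element in
the ranking `i` is an `i`-best point among those beating `B` in all rankings except `i`. -/
theorem IsDominant.beatsExcept_of_insert {I X L : Type*} [DecidableEq X] [LinearOrder L]
    {f : I → X → L} (hf : ∀ i, Function.Injective (f i)) {B : Finset X} {w : I → X}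
    (hw : ∀ k, w k ∈ B) (hmin : ∀ k, ∀ x ∈ B, f k (w k) ≤ f k x) {i : I}
    (hinj : ∀ k l, k ≠ i → l ≠ i → w k = w l → k = l) {x : X} (hxB : x ∉ B)
    (hd : IsDominant f (insert x B)) (hxi : ∀ z ∈ B, f i x ≤ f i z) :
    x ∈ beatsExcept f w i ∧ ∀ y ∈ beatsExcept f w i, f i y ≤ f i x := by
  constructor
  · intro k hki
    obtain ⟨l, hl⟩ := hd (w k)
    have hlk : w l = w k :=
      hf l (le_antisymm (hmin l _ (hw k)) (hl _ (Finset.mem_insert_of_mem (hw l))))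
    have hlx : f l (w k) ≤ f l x := hl x (Finset.mem_insert_self _ _)
    have hne : w k ≠ x := fun h => hxB (h ▸ hw k)
    have hli : l ≠ i := by
      rintro rfl
      exact hne (hf l (le_antisymm hlx (hxi _ (hw k))))
    obtain rfl := hinj l k hli hki hlk
    exact lt_of_le_of_ne hlx fun h => hne (hf _ h)
  · intro y hy
    obtain ⟨k, hk⟩ := hd y
    obtain rfl : k = i := by
      by_contra hki
      exact absurd (hy k hki) (hk _ (Finset.mem_insert_of_mem (hw k))).not_gt
    exact hk x (Finset.mem_insert_self _ _)

theorem exists_unique_max_of_injective {X L : Type*} [Finite X] [LinearOrder L] {g : X → L}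
    (hg : Function.Injective g) {M : Set X} (hM : M.Nonempty) :
    ∃ x ∈ M, (∀ y ∈ M, g y ≤ g x) ∧ ∀ z ∈ M, (∀ y ∈ M, g y ≤ g z) → z = x := by
  obtain ⟨x, hx, hmax⟩ := Set.exists_max_image M g M.toFinite hM
  exact ⟨x, hx, hmax, fun z hz h => hg (le_antisymm (hmax z hz) (h x hx))⟩

open Classical in
/-- A dominant set with one element fewer than there are rankings, and containing a point that is
not one of the slack points `s i`, has exactly two dominant one-point extensions. -/
theorem IsDominant.card_extensions_eq_two {I X L : Type*} [Fintype I] [Fintype X] [LinearOrder L]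
    {f : I → X → L} (hf : ∀ i, Function.Injective (f i)) {s : I → X}
    (hs : ∀ i j x, i ≠ j → x ∉ Set.range s → f i x < f i (s j))
    {B : Finset X} (hB : IsDominant f B) (hcard : B.card + 1 = Fintype.card I)
    {t : X} (htB : t ∈ B) (ht : t ∉ Set.range s) :
    (Finset.univ.filter fun x => x ∉ B ∧ IsDominant f (insert x B)).card = 2 := by
  have hw' : ∀ k, ∃ x ∈ B, ∀ y ∈ B, f k x ≤ f k y := fun k =>
    B.exists_min_image (f k) ⟨t, htB⟩
  choose w hw hmin using hw'
  have hsurj : ∀ x ∈ B, ∃ k, w k = x := fun x hx => by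
    obtain ⟨k, hk⟩ := hB x
    exact ⟨k, hf k (le_antisymm (hmin k x hx) (hk _ (hw k)))⟩
  obtain ⟨i, -, j, -, hij, hwij⟩ :=
    Finset.exists_ne_map_eq_of_card_lt_of_maps_to (s := Finset.univ) (t := B) (f := w)
      (by rw [Finset.card_univ]; omega) (fun k _ => hw k)
  -- Away from one of two colliding rankings the worst-element map is a bijection onto `B`.
  have key : ∀ i j, i ≠ j → w i = w j → ∀ k l, k ≠ i → l ≠ i → w k = w l → k = l := by
    intro i j hij hwij k l hk hl hkl
    have himg : (Finset.univ.erase i).image w = B := by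
      ext x
      simp only [Finset.mem_image, Finset.mem_erase, Finset.mem_univ, and_true]
      constructor
      · rintro ⟨k, -, rfl⟩
        exact hw k
      · intro hx
        obtain ⟨k, rfl⟩ := hsurj x hx
        by_cases hki : k = i
        · exact ⟨j, hij.symm, by rw [hki, hwij]⟩
        · exact ⟨k, hki, rfl⟩
    have hinj : Set.InjOn w (Finset.univ.erase i : Finset I) := by
      rw [← Finset.card_image_iff, himg, Finset.card_erase_of_mem (Finset.mem_univ _),
        Finset.card_univ]
      omega
    exact hinj (by simpa using hk) (by simpa using hl) hkl
  have hne : ∀ i, (beatsExcept f w i).Nonempty := fun i =>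
    ⟨s i, fun k hk => (hmin k t htB).trans_lt (hs k i t hk ht)⟩
  obtain ⟨a, ha, hamax, hauniq⟩ := exists_unique_max_of_injective (hf i) (hne i)
  obtain ⟨b, hb, hbmax, hbuniq⟩ := exists_unique_max_of_injective (hf j) (hne j)
  have hab : a ≠ b := by
    rintro rfl
    obtain ⟨k, hk⟩ := hB a
    by_cases hki : k = i
    · subst hki
      exact absurd (hb k hij) (hk _ (hw k)).not_gt
    · exact absurd (ha k hki) (hk _ (hw k)).not_gt
  rw [Finset.card_eq_two]
  refine ⟨a, b, hab, ?_⟩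
  ext x
  simp only [Finset.mem_filter, Finset.mem_univ, true_and, Finset.mem_insert,
    Finset.mem_singleton]
  constructor
  · rintro ⟨hxB, hd⟩
    obtain ⟨k, hk⟩ := hd x
    have hkB : ∀ z ∈ B, f k x ≤ f k z := fun z hz => hk z (Finset.mem_insert_of_mem hz)
    -- The ranking in which `x` becomes worst must be `i` or `j`: otherwise the former worst
    -- element of that ranking would no longer be worst anywhere.
    have hkij : k = i ∨ k = j := by
      by_contra! hcon
      obtain ⟨l, hl⟩ := hd (w k)
      have hlk : w l = w k :=
        hf l (le_antisymm (hmin l _ (hw k)) (hl _ (Finset.mem_insert_of_mem (hw l))))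
      have hlne : l ≠ k := by
        rintro rfl
        have := hf l (le_antisymm (hl x (Finset.mem_insert_self _ _)) (hkB _ (hw l)))
        exact hxB (this ▸ hw l)
      by_cases hli : l = i
      · exact hlne (key j i hij.symm hwij.symm l k (hli ▸ hij) hcon.2 hlk)
      · exact hlne (key i j hij hwij l k hli hcon.1 hlk)
    rcases hkij with rfl | rfl
    · obtain ⟨h1, h2⟩ := hd.beatsExcept_of_insert hf hw hmin (key k j hij hwij) hxB hkB
      exact Or.inl (hauniq x h1 h2)
    · obtain ⟨h1, h2⟩ := hd.beatsExcept_of_insert hf hw hmin (key k i hij.symm hwij.symm) hxB hkB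
      exact Or.inr (hbuniq x h1 h2)
  · rintro (rfl | rfl)
    · exact hB.insert_of_beatsExcept hw hmin hsurj hij hwij ha hamax
    · exact hB.insert_of_beatsExcept hw hmin hsurj hij.symm hwij.symm hb hbmax

theorem isDominant_image_erase {I X L : Type*} [Fintype I] [DecidableEq I] [DecidableEq X]
    [LinearOrder L] {f : I → X → L} {s : I → X} (hmin : ∀ i x, f i (s i) ≤ f i x)
    (hs : ∀ i j x, i ≠ j → x ∉ Set.range s → f i x < f i (s j)) {x : X} (i : I)
    (hx : x ∉ Set.range s) (hmax : ∀ y, y ∉ Set.range s → f i y ≤ f i x) :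
    IsDominant f (insert x ((Finset.univ.erase i).image s)) := by
  intro y
  by_cases hy : y ∈ Set.range s
  · obtain ⟨k, rfl⟩ := hy
    exact ⟨k, fun z _ => hmin k z⟩
  · refine ⟨i, fun z hz => ?_⟩
    rcases Finset.mem_insert.1 hz with rfl | hz
    · exact hmax y hy
    · obtain ⟨k, hk, rfl⟩ := Finset.mem_image.1 hz
      exact (hs i k y (Finset.ne_of_mem_erase hk).symm hy).le

open Classical in
/-- A set of all slack points but one has exactly one dominant one-point extension. -/
theorem card_extensions_image_erase {I X L : Type*} [Fintype I] [Fintype X] [LinearOrder L]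
    {f : I → X → L} (hf : ∀ i, Function.Injective (f i)) {s : I → X}
    (hmin : ∀ i x, f i (s i) ≤ f i x)
    (hs : ∀ i j x, i ≠ j → x ∉ Set.range s → f i x < f i (s j)) {t : X} (ht : t ∉ Set.range s)
    (i : I) :
    (Finset.univ.filter fun x => x ∉ (Finset.univ.erase i).image s ∧
      IsDominant f (insert x ((Finset.univ.erase i).image s))).card = 1 := by
  obtain ⟨a, ha, hamax, hauniq⟩ :=
    exists_unique_max_of_injective (hf i) (M := (Set.range s)ᶜ) ⟨t, ht⟩
  rw [Finset.card_eq_one]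
  refine ⟨a, ?_⟩
  ext x
  simp only [Finset.mem_filter, Finset.mem_univ, true_and, Finset.mem_singleton]
  have hsmem : ∀ k, k ≠ i → s k ∈ (Finset.univ.erase i).image s := fun k hk =>
    Finset.mem_image_of_mem s (by simpa using hk)
  constructor
  · rintro ⟨hxB, hd⟩
    have hx : x ∉ Set.range s := by
      rintro ⟨k, rfl⟩
      obtain rfl : k = i := by
        by_contra hk
        exact hxB (hsmem k hk)
      obtain ⟨l, hl⟩ := hd t
      have hsl : s l ∈ insert (s k) ((Finset.univ.erase k).image s) := by
        by_cases hlk : l = k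
        · rw [hlk]
          exact Finset.mem_insert_self _ _
        · exact Finset.mem_insert_of_mem (hsmem l hlk)
      exact ht ⟨l, hf l (le_antisymm (hmin l t) (hl _ hsl))⟩
    refine hauniq x hx fun y hy => ?_
    obtain ⟨k, hk⟩ := hd y
    obtain rfl : k = i := by
      by_contra hki
      exact hy ⟨k, hf k (le_antisymm (hmin k y) (hk _ (Finset.mem_insert_of_mem (hsmem k hki))))⟩
    exact hk x (Finset.mem_insert_self _ _)
  · rintro rfl
    refine ⟨fun h => ?_, isDominant_image_erase hmin hs i ha hamax⟩
    obtain ⟨k, -, rfl⟩ := Finset.mem_image.1 h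
    exact ha ⟨k, rfl⟩

/-- In a set with as many elements as there are colours that misses some colour, the number of
elements whose removal leaves exactly the colours other than `i` is even. -/
theorem even_card_filter_image_erase {I X : Type*} [Fintype I] [DecidableEq I] [DecidableEq X]
    (c : X → I) (i : I) {S : Finset X} (hcard : S.card = Fintype.card I)
    (hS : S.image c ≠ Finset.univ) :
    Even (S.filter fun x => (S.erase x).image c = Finset.univ.erase i).card := by
  rcases (S.filter fun x => (S.erase x).image c = Finset.univ.erase i).eq_empty_or_nonempty with
    h | ⟨a, ha⟩
  · simp [h]
  rw [Finset.mem_filter] at ha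
  obtain ⟨haS, ha⟩ := ha
  have hcol : ∀ k, k ≠ i → ∃ b ∈ S, b ≠ a ∧ c b = k := fun k hk => by
    have : k ∈ (S.erase a).image c := by rw [ha]; simpa using hk
    obtain ⟨b, hb, hbk⟩ := Finset.mem_image.1 this
    exact ⟨b, Finset.mem_of_mem_erase hb, Finset.ne_of_mem_erase hb, hbk⟩
  have hnei : ∀ b ∈ S, b ≠ a → c b ≠ i := fun b hb hba => by
    have : c b ∈ (S.erase a).image c := Finset.mem_image_of_mem c (Finset.mem_erase.2 ⟨hba, hb⟩)
    rw [ha] at this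
    exact Finset.ne_of_mem_erase this
  have hai : c a ≠ i := by
    intro hai
    refine hS (Finset.eq_univ_iff_forall.2 fun k => ?_)
    by_cases hk : k = i
    · exact Finset.mem_image.2 ⟨a, haS, by rw [hai, hk]⟩
    · obtain ⟨b, hb, -, hbk⟩ := hcol k hk
      exact Finset.mem_image.2 ⟨b, hb, hbk⟩
  obtain ⟨b, hb, hba, hbc⟩ := hcol (c a) hai
  have hset : (S.filter fun x => (S.erase x).image c = Finset.univ.erase i) = {a, b} := by
    ext z
    simp only [Finset.mem_filter, Finset.mem_insert, Finset.mem_singleton]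
    constructor
    · rintro ⟨hz, hzi⟩
      by_contra! hcon
      have hinj : Set.InjOn c (S.erase z : Finset X) := by
        rw [← Finset.card_image_iff, hzi, Finset.card_erase_of_mem (Finset.mem_univ _),
          Finset.card_erase_of_mem hz, hcard, Finset.card_univ]
      exact hba (hinj (by simp [hb, hcon.2.symm]) (by simp [haS, hcon.1.symm]) hbc)
    · rintro (rfl | rfl)
      · exact ⟨haS, ha⟩
      · refine ⟨hb, ?_⟩
        ext k
        simp only [Finset.mem_image, Finset.mem_erase, Finset.mem_univ, and_true]
        constructor
        · rintro ⟨x, ⟨-, hx⟩, rfl⟩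
          by_cases hxa : x = a
          · rwa [hxa]
          · exact hnei x hx hxa
        · intro hk
          obtain ⟨x, hx, hxa, rfl⟩ := hcol k hk
          by_cases hxz : x = z
          · exact ⟨a, ⟨hba.symm, haS⟩, by rw [hxz, hbc]⟩
          · exact ⟨x, ⟨hxz, hx⟩, rfl⟩
  rw [hset, Finset.card_pair hba.symm]
  exact even_two

open Classical in
/-- Scarf's lemma: a dominant set meeting every colour exactly once exists. It follows by
counting in two ways the pairs of a dominant set, one element short and missing only the colour
`i₀`, and a dominant one-point extension of it. -/
theorem exists_isDominant_image_eq_univ {I X L : Type*} [Fintype I] [Nonempty I] [Fintype X]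
    [LinearOrder L] {f : I → X → L} (hf : ∀ i, Function.Injective (f i)) {s : I → X}
    (hmin : ∀ i x, f i (s i) ≤ f i x)
    (hs : ∀ i j x, i ≠ j → x ∉ Set.range s → f i x < f i (s j)) {t : X} (ht : t ∉ Set.range s)
    (c : X → I) (hc : ∀ i, c (s i) = i) :
    ∃ B : Finset X, B.card = Fintype.card I ∧ IsDominant f B ∧ B.image c = Finset.univ := by
  by_contra! hcon
  obtain ⟨i₀⟩ := ‹Nonempty I›
  set D : Finset (Finset X) := Finset.univ.filter fun B =>
    B.card + 1 = Fintype.card I ∧ IsDominant f B ∧ B.image c = Finset.univ.erase i₀ with hD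
  set R : Finset (Finset X) := Finset.univ.filter fun B =>
    B.card = Fintype.card I ∧ IsDominant f B with hR
  have hcount : ∑ B ∈ D, (Finset.univ.filter fun x => x ∉ B ∧ IsDominant f (insert x B)).card =
      ∑ S ∈ R, (S.filter fun x => (S.erase x).image c = Finset.univ.erase i₀).card := by
    rw [← Finset.card_sigma, ← Finset.card_sigma]
    refine Finset.card_bij' (fun p _ => ⟨insert p.2 p.1, p.2⟩) (fun p _ => ⟨p.1.erase p.2, p.2⟩)
      ?_ ?_ ?_ ?_
    · rintro ⟨B, x⟩ h
      simp only [hD, hR, Finset.mem_sigma, Finset.mem_filter, Finset.mem_univ, true_and] at h ⊢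
      obtain ⟨⟨h1, h2, h3⟩, h4, h5⟩ := h
      refine ⟨⟨by rw [Finset.card_insert_of_notMem h4, h1], h5⟩, Finset.mem_insert_self _ _, ?_⟩
      rw [Finset.erase_insert h4, h3]
    · rintro ⟨S, x⟩ h
      simp only [hD, hR, Finset.mem_sigma, Finset.mem_filter, Finset.mem_univ, true_and] at h ⊢
      obtain ⟨⟨h1, h2⟩, h3, h4⟩ := h
      refine ⟨⟨?_, h2.mono (Finset.erase_subset _ _), h4⟩, Finset.notMem_erase _ _, ?_⟩
      · rw [Finset.card_erase_add_one h3, h1]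
      · rwa [Finset.insert_erase h3]
    · rintro ⟨B, x⟩ h
      simp only [Finset.mem_sigma, Finset.mem_filter, Finset.mem_univ, true_and] at h
      simp [Finset.erase_insert h.2.1]
    · rintro ⟨S, x⟩ h
      simp only [Finset.mem_sigma, Finset.mem_filter] at h
      simp [Finset.insert_erase h.2.1]
  have hright : Even (∑ S ∈ R,
      (S.filter fun x => (S.erase x).image c = Finset.univ.erase i₀).card) := by
    refine Finset.even_sum _ fun S hS => ?_
    rw [hR, Finset.mem_filter] at hS
    exact even_card_filter_image_erase c i₀ hS.2.1 (hcon S hS.2.1 hS.2.2)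
  have hsinj : Function.Injective s := Function.LeftInverse.injective hc
  set B₀ : Finset X := (Finset.univ.erase i₀).image s with hB₀
  have hB₀D : B₀ ∈ D := by
    rw [hD, Finset.mem_filter]
    refine ⟨Finset.mem_univ _, ?_, ?_, ?_⟩
    · rw [hB₀, Finset.card_image_of_injective _ hsinj,
        Finset.card_erase_add_one (Finset.mem_univ _), Finset.card_univ]
    · obtain ⟨a, ha, hamax, -⟩ :=
        exists_unique_max_of_injective (hf i₀) (M := (Set.range s)ᶜ) ⟨t, ht⟩
      exact (isDominant_image_erase hmin hs i₀ ha hamax).mono (Finset.subset_insert _ _)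
    · rw [hB₀, Finset.image_image, show c ∘ s = id from funext hc, Finset.image_id]
  have hleft : Odd (∑ B ∈ D,
      (Finset.univ.filter fun x => x ∉ B ∧ IsDominant f (insert x B)).card) := by
    rw [← Finset.add_sum_erase _ _ hB₀D, card_extensions_image_erase hf hmin hs ht i₀]
    refine odd_one.add_even (Finset.even_sum _ fun B hB => ?_)
    obtain ⟨hne, hB⟩ := Finset.mem_erase.1 hB
    rw [hD, Finset.mem_filter] at hB
    obtain ⟨-, h1, h2, h3⟩ := hB
    -- A set of slack points missing only the colour `i₀` would be `B₀`.
    have : ∃ x ∈ B, x ∉ Set.range s := by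
      by_contra! hcon'
      refine hne (Finset.eq_of_subset_of_card_le ?_ ?_)
      · intro x hx
        obtain ⟨k, rfl⟩ := hcon' x hx
        have := Finset.mem_image_of_mem c hx
        rw [h3, hc] at this
        exact Finset.mem_image_of_mem s this
      · rw [hB₀, Finset.card_image_of_injective _ hsinj,
          Finset.card_erase_of_mem (Finset.mem_univ _), Finset.card_univ]
        omega
    obtain ⟨x, hx, hxs⟩ := this
    rw [h2.card_extensions_eq_two hf hs h1 hx hxs]
    exact even_two
  rw [hcount] at hleft
  exact (Nat.not_odd_iff_even.2 hright) hleft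

/-! ### Variational inequalities on the standard simplex -/

/-- The `i`-th ranking of grid points `p` (by the coordinate `p i`) and slack points `j`, with ties
broken by an enumeration `e`. The slack point `i` comes last in the ranking `i`, and the other slack
points come before all grid points. -/
def gridRank {I T : Type*} [DecidableEq I] (N : ℕ) (v : T → I → ℕ) (e : T ⊕ I → ℕ) (i : I)
    (x : T ⊕ I) : ℕ ×ₗ ℕ :=
  toLex (Sum.elim (fun p => v p i + 1) (fun j => if j = i then 0 else N + 2) x, e x)

theorem Prod.Lex.fst_le_of_toLex_le {a b : ℕ × ℕ} (h : toLex a ≤ toLex b) : a.1 ≤ b.1 := by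
  rcases Prod.Lex.toLex_le_toLex.1 h with h | h
  · exact h.le
  · exact h.1.le

open Classical in
/-- For every colouring of the points of the integer grid `{p | ∑ p = N}` there are a nonempty set
`C` of colours and, in each colour of `C`, a point, such that these points are close to each other
and to the face of the simplex spanned by `C`. -/
theorem exists_close_grid_points {I : Type*} [Fintype I] [Nonempty I] (N : ℕ)
    (c : (I → ℕ) → I) :
    ∃ (C : Finset I) (p : I → I → ℕ), C.Nonempty ∧
      (∀ i ∈ C, ∑ k, p i k = N ∧ c (p i) = i ∧ ∀ j, j ∉ C → p i j < Fintype.card I) ∧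
      ∀ i ∈ C, ∀ j ∈ C, ∀ k, p i k < p j k + Fintype.card I := by
  let T := {p : I → Fin (N + 1) // ∑ i, (p i : ℕ) = N}
  let v : T → I → ℕ := fun p i => p.1 i
  have hv : ∀ y : I → ℕ, ∑ i, y i = N → ∃ t : T, v t = y := by
    intro y hy
    have hle : ∀ i, y i < N + 1 := fun i => by
      have := Finset.single_le_sum (f := y) (fun _ _ => Nat.zero_le _) (Finset.mem_univ i)
      omega
    exact ⟨⟨fun i => ⟨y i, hle i⟩, hy⟩, rfl⟩
  have hvsum : ∀ t : T, ∑ i, v t i = N := fun t => t.2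
  obtain ⟨i₁⟩ := ‹Nonempty I›
  have hvle : ∀ (t : T) i, v t i ≤ N := fun t i => Nat.lt_succ_iff.1 (t.1 i).2
  let e : T ⊕ I → ℕ := fun x => Fintype.equivFin (T ⊕ I) x
  have he : Function.Injective e := fun x y h =>
    (Fintype.equivFin (T ⊕ I)).injective (Fin.ext h)
  obtain ⟨t₀, -⟩ := hv (Pi.single i₁ N) (by simp)
  have : Nonempty I := ⟨i₁⟩
  obtain ⟨B, -, hB, hBc⟩ := exists_isDominant_image_eq_univ (f := gridRank N v e)
    (s := Sum.inr) (t := Sum.inl t₀)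
    (fun i x y h => he (congrArg (fun a => (ofLex a).2) h))
    (by
      rintro i (p | j)
      · exact (Prod.Lex.toLex_lt_toLex.2 (Or.inl (by simp))).le
      · by_cases hj : j = i
        · rw [hj]
        · exact (Prod.Lex.toLex_lt_toLex.2 (Or.inl (by simp [hj]))).le)
    (by
      rintro i j (p | k) hij hx
      · refine Prod.Lex.toLex_lt_toLex.2 (Or.inl ?_)
        have := hvle p i
        simp only [Sum.elim_inl, Sum.elim_inr, hij.symm, if_false]
        omega
      · exact absurd ⟨k, rfl⟩ hx)
    (by simp) (Sum.elim (fun p => c (v p)) id) (fun _ => rfl)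
  let C : Finset I := Finset.univ.filter fun i => Sum.inr i ∉ B
  have hC : ∀ i, i ∈ C ↔ Sum.inr i ∉ B := fun i => by simp [C]
  -- Dominance of `B` in terms of coordinates.
  have hdom : ∀ y : I → ℕ, ∑ i, y i = N → ∃ i ∈ C, ∀ t, Sum.inl t ∈ B → y i ≤ v t i := by
    intro y hy
    obtain ⟨t, rfl⟩ := hv y hy
    obtain ⟨i, hi⟩ := hB (Sum.inl t)
    refine ⟨i, (hC i).2 fun hiB => ?_, fun t' ht' => ?_⟩
    · have := Prod.Lex.fst_le_of_toLex_le (hi _ hiB)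
      simp at this
    · have := Prod.Lex.fst_le_of_toLex_le (hi _ ht')
      simpa using this
  have hcol : ∀ i, ∃ t : T, i ∈ C → Sum.inl t ∈ B ∧ c (v t) = i := by
    intro i
    by_cases hi : i ∈ C
    · have : i ∈ B.image (Sum.elim (fun p => c (v p)) id) := hBc ▸ Finset.mem_univ i
      obtain ⟨x, hx, hxi⟩ := Finset.mem_image.1 this
      rcases x with t | j
      · exact ⟨t, fun _ => ⟨hx, hxi⟩⟩
      · obtain rfl : j = i := hxi
        exact absurd hx ((hC j).1 hi)
    · exact ⟨t₀, fun h => absurd h hi⟩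
  choose t ht using hcol
  obtain ⟨i₀, hi₀, -⟩ := hdom (v t₀) (hvsum t₀)
  have hmin : ∀ k, ∃ j ∈ C, ∀ i ∈ C, v (t j) k ≤ v (t i) k := fun k =>
    C.exists_min_image (fun i => v (t i) k) ⟨i₀, hi₀⟩
  choose a haC ha using hmin
  let μ : I → ℕ := fun k => v (t (a k)) k
  -- Otherwise some grid point would exceed all minima `μ k`, `k ∈ C`.
  have hsum : N < ∑ k ∈ C, (μ k + 1) := by
    by_contra! hle
    let y : I → ℕ := fun k => (if k ∈ C then μ k + 1 else 0) +
      (if k = i₀ then N - ∑ k ∈ C, (μ k + 1) else 0)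
    have hy : ∑ k, y k = N := by
      simp only [y, Finset.sum_add_distrib, Finset.sum_ite_mem, Finset.univ_inter,
        Finset.sum_ite_eq', Finset.mem_univ, if_true] at hle ⊢
      omega
    obtain ⟨i, hiC, hi⟩ := hdom y hy
    have h1 := hi _ (ht _ (haC i)).1
    have h2 : μ i + 1 ≤ y i := by simp [y, hiC]
    have h3 : v (t (a i)) i = μ i := rfl
    omega
  rw [Finset.sum_add_distrib, Finset.sum_const, smul_eq_mul, mul_one] at hsum
  have hCcard : C.card ≤ Fintype.card I := Finset.card_le_univ C
  have hout : ∀ i ∈ C, ∀ j, j ∉ C → v (t i) j < Fintype.card I := by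
    intro i hi j hj
    have h1 : ∑ k ∈ insert j C, v (t i) k ≤ N :=
      (Finset.sum_le_sum_of_subset (Finset.subset_univ _)).trans (hvsum _).le
    rw [Finset.sum_insert hj] at h1
    have h2 : ∑ k ∈ C, μ k ≤ ∑ k ∈ C, v (t i) k := Finset.sum_le_sum fun k _ => ha k i hi
    omega
  refine ⟨C, fun i => v (t i), ⟨i₀, hi₀⟩, fun i hi => ⟨hvsum _, (ht i hi).2, hout i hi⟩, ?_⟩
  intro i hi j hj k
  by_cases hk : k ∈ C
  · have h1 : ∑ k ∈ C, v (t i) k ≤ N :=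
      (Finset.sum_le_sum_of_subset (Finset.subset_univ _)).trans (hvsum _).le
    have h2 : ∑ k ∈ C.erase k, μ k ≤ ∑ k ∈ C.erase k, v (t i) k :=
      Finset.sum_le_sum fun k _ => ha k i hi
    rw [← Finset.add_sum_erase _ _ hk] at h1 hsum
    have h3 : μ k ≤ v (t j) k := ha k j hj
    show v (t i) k < v (t j) k + _
    omega
  · have := hout i hi k hk
    show v (t i) k < v (t j) k + _
    omega

/-- Approximate solutions, at scale `1 / (N + 1)`, of the variational inequality on the standard
simplex, for an arbitrary map `G`. -/
theorem exists_approx_variational {I : Type*} [Fintype I] [Nonempty I]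
    (G : (I → ℝ) → I → ℝ) (N : ℕ) :
    ∃ (z : I → ℝ) (w : I → I → ℝ), z ∈ stdSimplex ℝ I ∧
      (∀ i, w i ∈ stdSimplex ℝ I ∧ ∀ k, |w i k - z k| ≤ Fintype.card I / ((N : ℝ) + 1)) ∧
      ∀ i, Fintype.card I / ((N : ℝ) + 1) < z i → ∀ j, G (w i) i ≤ G (w i) j := by
  classical
  let σ : (I → ℕ) → I → ℝ := fun p k => p k / ((N : ℝ) + 1)
  have hN : (0 : ℝ) < (N : ℝ) + 1 := by positivity
  have hc : ∀ p : I → ℕ, ∃ i, ∀ j, G (σ p) i ≤ G (σ p) j := fun p => Finite.exists_min _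
  choose c hc using hc
  -- The grid of mesh `1 / (N + 1)`, so that the denominator never vanishes.
  obtain ⟨C, p, ⟨i₀, hi₀⟩, hp, hclose⟩ := exists_close_grid_points (N + 1) c
  have hσ : ∀ i ∈ C, σ (p i) ∈ stdSimplex ℝ I := by
    intro i hi
    refine ⟨fun k => by positivity, ?_⟩
    simp only [σ]
    rw [← Finset.sum_div, ← Nat.cast_sum, (hp i hi).1]
    push_cast
    exact div_self hN.ne'
  refine ⟨σ (p i₀), fun i => if i ∈ C then σ (p i) else σ (p i₀), hσ i₀ hi₀, fun i => ?_, ?_⟩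
  · by_cases hi : i ∈ C
    · simp only [hi, if_true]
      refine ⟨hσ i hi, fun k => ?_⟩
      have h1 : (p i k : ℝ) < p i₀ k + Fintype.card I := by exact_mod_cast hclose i hi i₀ hi₀ k
      have h2 : (p i₀ k : ℝ) < p i k + Fintype.card I := by exact_mod_cast hclose i₀ hi₀ i hi k
      simp only [σ]
      rw [← sub_div, abs_div, abs_of_pos hN]
      gcongr
      rw [abs_le]
      constructor <;> linarith
    · simp only [hi, if_false]
      refine ⟨hσ i₀ hi₀, fun k => ?_⟩
      rw [sub_self, abs_zero]
      positivity
  · intro i hi j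
    have hiC : i ∈ C := by
      by_contra hiC
      have h1 : (p i₀ i : ℝ) < Fintype.card I := by exact_mod_cast (hp i₀ hi₀).2.2 i hiC
      have h2 : σ (p i₀) i < Fintype.card I / ((N : ℝ) + 1) := by
        simp only [σ]
        gcongr
      exact lt_asymm hi h2
    simp only [hiC, if_true]
    have := hc (p i) j
    rwa [(hp i hiC).2.1] at this

open Filter Topology in
/-- A continuous map `G` on the standard simplex admits a point `x` at which `G x` attains its
smallest coordinate at every index in the support of `x`. -/
theorem exists_variational_stdSimplex {I : Type*} [Fintype I] [Nonempty I]
    (G : (I → ℝ) → I → ℝ) (hG : ContinuousOn G (stdSimplex ℝ I)) :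
    ∃ x ∈ stdSimplex ℝ I, ∀ i, 0 < x i → ∀ j, G x i ≤ G x j := by
  choose z w hz hw hmin using exists_approx_variational G
  obtain ⟨x, hx, φ, hφ, hlim⟩ := (isCompact_stdSimplex ℝ I).tendsto_subseq hz
  refine ⟨x, hx, fun i hi j => ?_⟩
  have hε : Tendsto (fun n => (Fintype.card I : ℝ) / ((φ n : ℝ) + 1)) atTop (𝓝 0) :=
    (tendsto_const_nhds.div_atTop
      (tendsto_atTop_add_const_right _ _ tendsto_natCast_atTop_atTop)).comp hφ.tendsto_atTop
  have hwlim : Tendsto (fun n => w (φ n) i) atTop (𝓝 x) := by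
    rw [tendsto_pi_nhds]
    intro k
    have h1 : Tendsto (fun n => w (φ n) i k - z (φ n) k) atTop (𝓝 0) :=
      squeeze_zero_norm (fun n => (hw (φ n) i).2 k) hε
    simpa using h1.add ((tendsto_pi_nhds.1 hlim) k)
  have hGlim : Tendsto (fun n => G (w (φ n) i)) atTop (𝓝 (G x)) :=
    (hG x hx).tendsto.comp
      (tendsto_nhdsWithin_iff.2 ⟨hwlim, Eventually.of_forall fun n => (hw (φ n) i).1⟩)
  refine le_of_tendsto_of_tendsto ((tendsto_pi_nhds.1 hGlim) i) ((tendsto_pi_nhds.1 hGlim) j) ?_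
  filter_upwards [hε.eventually_lt ((tendsto_pi_nhds.1 hlim) i) hi] with n hn
  exact hmin (φ n) i hn j

/-! ### Tensor complementarity problems -/

theorem RealTensor.mulVecPow_smul {m n : ℕ} (A : RealTensor m n) (r : ℝ) (x : Fin n → ℝ)
    (i : Fin n) : A.mulVecPow (r • x) i = r ^ (m - 1) * A.mulVecPow x i := by
  simp only [RealTensor.mulVecPow, Finset.mul_sum, Pi.smul_apply, smul_eq_mul,
    Finset.prod_mul_distrib, Finset.prod_const, Finset.card_univ, Fintype.card_fin]
  exact Finset.sum_congr rfl fun _ _ => by ring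

theorem RealTensor.continuous_mulVecPow {m n : ℕ} (A : RealTensor m n) :
    Continuous A.mulVecPow := by
  unfold RealTensor.mulVecPow
  fun_prop

/-- If `(q, 𝒜)` has no solution, the variational inequality for `x ↦ 𝒜 x^{m-1} + r^{-(m-1)} q` on
`{x ≥ 0 | ∑ x ≤ 1}` has a solution with `∑ x = 1`; its multiplier is the common value of minus the
coordinates of the map on the support of `x`. -/
theorem RealTensor.exists_boundary_variational {m n : ℕ} (A : RealTensor m n) (q : Fin n → ℝ)
    (hq : ¬ ∃ x, RealTensor.IsTCPSolution q A x) {r : ℝ} (hr : 0 < r) :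
    ∃ y ∈ stdSimplex ℝ (Fin n), ∀ i, 0 < y i →
      A.mulVecPow y i + (r ^ (m - 1))⁻¹ * q i ≤ 0 ∧
      ∀ j, A.mulVecPow y i + (r ^ (m - 1))⁻¹ * q i ≤
        A.mulVecPow y j + (r ^ (m - 1))⁻¹ * q j := by
  let F : (Fin n → ℝ) → Fin n → ℝ := fun y i => A.mulVecPow y i + (r ^ (m - 1))⁻¹ * q i
  have hF : Continuous F := by
    have := A.continuous_mulVecPow
    fun_prop
  -- The slack coordinate `none` turns `∑ y ≤ 1` into the standard simplex.
  let G : (Option (Fin n) → ℝ) → Option (Fin n) → ℝ := fun x o =>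
    o.elim 0 (F fun i => x (some i))
  have hG : Continuous G := by
    refine continuous_pi fun o => ?_
    cases o with
    | none => exact continuous_const
    | some i =>
      exact (continuous_apply i).comp (hF.comp (continuous_pi fun i => continuous_apply (some i)))
  obtain ⟨x, ⟨hx0, hx1⟩, hx⟩ := exists_variational_stdSimplex G hG.continuousOn
  let y : Fin n → ℝ := fun i => x (some i)
  rw [Fintype.sum_option] at hx1
  have hcomp : ∀ i, 0 < y i → F y i ≤ 0 ∧ ∀ j, F y i ≤ F y j := fun i hi =>
    ⟨hx (some i) hi none, fun j => hx (some i) hi (some j)⟩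
  rcases (hx0 none).eq_or_lt with h0 | h0
  · refine ⟨y, ⟨fun i => hx0 _, ?_⟩, hcomp⟩
    rw [← h0, zero_add] at hx1
    exact hx1
  · -- With positive slack, rescaling by `r` solves the complementarity problem.
    refine absurd ⟨r • y, ?_⟩ hq
    have hpos : 0 < r ^ (m - 1) := pow_pos hr _
    have hFy : ∀ i, (q + A.mulVecPow (r • y)) i = r ^ (m - 1) * F y i := fun i => by
      rw [Pi.add_apply, A.mulVecPow_smul]
      simp only [F]
      field_simp
      ring
    have hF0 : ∀ i, 0 ≤ F y i := fun i => hx none h0 (some i)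
    refine ⟨fun i => mul_nonneg hr.le (hx0 _), fun i => ?_, ?_⟩
    · rw [hFy]
      exact mul_nonneg hpos.le (hF0 i)
    · refine Finset.sum_eq_zero fun i _ => ?_
      rw [hFy]
      rcases (hx0 (some i)).eq_or_lt with hi | hi
      · have : (r • y) i = 0 := by
          show r * x (some i) = 0
          rw [← hi]
          exact mul_zero r
        rw [this, zero_mul]
      · rw [le_antisymm (hcomp i hi).1 (hF0 i), mul_zero, mul_zero]

open Filter Topology in
theorem mainTheorem1 {m n : ℕ} (hm : 2 ≤ m) (A : RealTensor m n) (hA : A.IsRTensor) :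
    A.IsQTensor := by
  intro q
  by_contra hq
  have hy : ∀ k : ℕ, _ := fun k =>
    A.exists_boundary_variational q hq (r := (k : ℝ) + 1) (by positivity)
  choose y hyS hy using hy
  obtain ⟨x, ⟨hx0, hx1⟩, φ, hφ, hlim⟩ := (isCompact_stdSimplex ℝ (Fin n)).tendsto_subseq hyS
  have hscale : Tendsto (fun k : ℕ => (((φ k : ℝ) + 1) ^ (m - 1))⁻¹) atTop (𝓝 0) :=
    ((tendsto_pow_atTop (by omega)).comp
      (tendsto_atTop_add_const_right _ _ tendsto_natCast_atTop_atTop)).inv_tendsto_atTop.comp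
      hφ.tendsto_atTop
  have hFlim : ∀ i, Tendsto (fun k => A.mulVecPow (y (φ k)) i +
      (((φ k : ℝ) + 1) ^ (m - 1))⁻¹ * q i) atTop (𝓝 (A.mulVecPow x i)) := fun i => by
    simpa using ((tendsto_pi_nhds.1 ((A.continuous_mulVecPow.tendsto x).comp hlim)) i).add
      (hscale.mul_const (q i))
  have hev : ∀ i, 0 < x i → ∀ᶠ k in atTop, 0 < y (φ k) i := fun i hi =>
    ((tendsto_pi_nhds.1 hlim) i).eventually_const_lt hi
  have hle0 : ∀ i, 0 < x i → A.mulVecPow x i ≤ 0 := fun i hi =>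
    le_of_tendsto (hFlim i) ((hev i hi).mono fun k hk => (hy (φ k) i hk).1)
  have hle : ∀ i, 0 < x i → ∀ j, A.mulVecPow x i ≤ A.mulVecPow x j := fun i hi j =>
    le_of_tendsto_of_tendsto (hFlim i) (hFlim j) ((hev i hi).mono fun k hk => (hy (φ k) i hk).2 j)
  obtain ⟨i, hi⟩ : ∃ i, 0 < x i := by
    by_contra! hcon
    have : ∑ i, x i ≤ 0 := Finset.sum_nonpos fun i _ => hcon i
    linarith
  -- On the support of `x` all coordinates of `𝒜 x^{m-1}` agree, and `t` is minus their value.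
  refine hA ⟨x, -A.mulVecPow x i, ?_, hx0, neg_nonneg.2 (hle0 i hi), fun j hj => ?_, fun j _ => ?_⟩
  · rintro rfl
    exact lt_irrefl _ hi
  · linarith [hle i hi j, hle j hj i]
  · linarith [hle i hi j]
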